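/- Let $\mathbb{N}_0^{\mathbb{N}}$ (resp. $\mathbb{Z}_0^{\mathbb{N}}$) denote the finitely supported sequences of non-negative integers (resp. integers) with entrywise addition. An $\mathbb{N}$-graph is a countable category $\Lambda$, with range and source maps $r,s$ and composition $\lambda\mu$ defined when $s(\lambda)=r(\mu)$, together with a functor $d:\Lambda\to\mathbb{N}_0^{\mathbb{N}}$ such that whenever $d(\lambda)=m+n$ there are unique $\mu,\nu\in\Lambda$ with $\lambda=\mu\nu$, $d(\mu)=m$, $d(\nu)=n$. Write $\Lambda^n=d^{-1}(n)$, identify the objects (vertices) with $\Lambda^0$, put $v\Lambda^n=\{\lambda\in\Lambda^n: r(\lambda)=v\}$, and let $\Lambda^{\neq 0}$ be the set of paths of nonzero degree. $\Lambda$ is row-finite if every $v\Lambda^n$ is finite, and has no source if every $v\Lambda^n$ is nonempty. Let $R$ be a commutative ring with $1$; $R$-algebras are associative and need not be unital. For a row-finite $\mathbb{N}$-graph $\Lambda$, a Kumjian–Pask $\Lambda$-family $(P,S)$ in an $R$-algebra $A$ consists of elements $P_v$ ($v\in\Lambda^0$) and $S_\lambda,S_{\lambda^*}$ ($\lambda\in\Lambda^{\neq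 0}$) of $A$ such that 1. the $P_v$ are mutually orthogonal idempotents; 2. for $\lambda,\mu\in\Lambda^{\neq0}$ with $s(\lambda)=r(\mu)$: $S_\lambda S_\mu=S_{\lambda\mu}$ and $S_{\mu^*}S_{\lambda^*}=S_{(\lambda\mu)^*}$; and for $\lambda\in\Lambda^{\neq0}$: $P_{r(\lambda)}S_\lambda=S_\lambda=S_\lambda P_{s(\lambda)}$ and $P_{s(\lambda)}S_{\lambda^*}=S_{\lambda^*}=S_{\lambda^*}P_{r(\lambda)}$; 3. $S_{\lambda^*}S_\mu=\delta_{\lambda,\mu}P_{s(\lambda)}$ for all $\lambda,\mu\in\Lambda^n$, $n\neq0$; 4. $P_v=\sum_{\lambda\in v\Lambda^n}S_\lambda S_{\lambda^*}$ for all $v\in\Lambda^0$ and $n\neq0$. Theorem. Let $\Lambda$ be a row-finite $\mathbb{N}$-graph with no source, and let $R$ be a commutative ring with $1$. (i) There is an $R$-algebra $KP_R(\Lambda)$, generated by a Kumjian–Pask $\Lambda$-family $(p,s)$, such that for every Kumjian–Pask $\Lambda$-family $(Q,T)$ in an $R$-algebra $A$ there is a unique $R$-algebra homomorphism $\pi_{Q,T}:KP_R(\Lambda)\to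 A$ with $\pi_{Q,T}\circ p=Q$ and $\pi_{Q,T}\circ s=T$. The pair consisting of this algebra and its family is unique up to a unique isomorphism carrying one family to the other. Moreover $rp_v\neq0$ for every $r\in R\setminus\{0\}$ and $v\in\Lambda^0$. (ii) For $n\in\mathbb{Z}_0^{\mathbb{N}}$ put $KP_R(\Lambda)_n:=\operatorname{span}_R\{s_\alpha s_{\beta^*}:\alpha,\beta\in\Lambda,\ d(\alpha)-d(\beta)=n\}$, where $s_v=s_{v^*}=p_v$ for vertices $v$. These submodules form a $\mathbb{Z}_0^{\mathbb{N}}$-grading of $KP_R(\Lambda)$: $KP_R(\Lambda)=\bigoplus_n KP_R(\Lambda)_n$ and $KP_R(\Lambda)_m\,KP_R(\Lambda)_n\subseteq KP_R(\Lambda)_{m+n}$ for all $m,n$. -/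

import Mathlib

open CategoryTheory

universe u v w t

/-- An `ℕ`-graph: a countable category with a degree functor into `ℕ →₀ ℕ` (finitely supported
sequences of natural numbers, regarded as a category with one object) that has the unique
factorization property.

A path `l` is a morphism from its source `s(l)` to its range `r(l)`. The product `l m` of paths,
defined when `s(l) = r(m)`, is therefore the morphism `m ≫ l` in Mathlib's notation.
By unique factorization the morphisms of degree `0` are exactly the identities, so the objects
are the vertices. -/
class NGraph (Λ : Type u) extends Category.{v} Λ where
  countable_hom : Countable (Σ x y : Λ, x ⟶ y)
  deg : ∀ {x y : Λ}, (x ⟶ y) → (ℕ →₀ ℕ)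
  deg_id : ∀ x : Λ, deg (𝟙 x) = 0
  deg_comp : ∀ {x y z : Λ} (m : x ⟶ y) (l : y ⟶ z), deg (m ≫ l) = deg l + deg m
  factorization : ∀ {x z : Λ} (l : x ⟶ z) (m n : ℕ →₀ ℕ), deg l = m + n →
    ∃! q : (Σ y : Λ, (y ⟶ z) × (x ⟶ y)),
      deg q.2.1 = m ∧ deg q.2.2 = n ∧ q.2.2 ≫ q.2.1 = l

namespace NGraph

variable (Λ : Type u) [NGraph.{u, v} Λ]

/-- The set of all paths (morphisms) of the `ℕ`-graph. -/
@[ext]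
structure Path where
  /-- the source of the path -/
  source : Λ
  /-- the range of the path -/
  range : Λ
  /-- the path as a morphism from its source to its range -/
  hom : source ⟶ range

variable {Λ}

/-- The degree of a path. -/
def Path.deg (l : Path Λ) : ℕ →₀ ℕ := NGraph.deg l.hom

/-- The set of paths of degree `n` with range `x`. -/
def pathsInto (x : Λ) (n : ℕ →₀ ℕ) : Set (Path Λ) := {l | l.range = x ∧ l.deg = n}

variable (Λ)

/-- Every vertex receives only finitely many paths of each degree. -/
def RowFinite : Prop := ∀ (x : Λ) (n : ℕ →₀ ℕ), (pathsInto x n).Finite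

/-- Every vertex receives at least one path of each degree. -/
def NoSources : Prop := ∀ (x : Λ) (n : ℕ →₀ ℕ), (pathsInto x n).Nonempty

/-- The paths that are not vertices, i.e. the paths of nonzero degree. -/
def Edge : Type (max u v) := {l : Path Λ // l.deg ≠ 0}

variable {Λ}

/-- A morphism of nonzero degree, as a path that is not a vertex. -/
def Edge.of {x y : Λ} (l : x ⟶ y) (hl : deg l ≠ 0) : Edge Λ := ⟨⟨x, y, l⟩, hl⟩

theorem deg_comp_ne_zero {x y z : Λ} (m : x ⟶ y) (l : y ⟶ z) (hl : deg l ≠ 0) :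
    deg (m ≫ l) ≠ 0 := by
  intro h
  rw [deg_comp, add_eq_zero] at h
  exact hl h.1

end NGraph

open NGraph

open scoped Classical in
/-- A Kumjian–Pask `Λ`-family in a (not necessarily unital) algebra `A`, for a row-finite
`ℕ`-graph `Λ`. The function on nontrivial paths and nontrivial ghost paths is given by its two
restrictions `S` (paths) and `S'` (ghost paths), so `S' l` stands for `S_{l^*}`.
The sums in `kp4` are finite because `Λ` is row-finite. -/
structure KumjianPaskFamily (Λ : Type u) [NGraph.{u, v} Λ] (A : Type w) [NonUnitalRing A] where
  P : Λ → A
  S : Edge Λ → A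
  S' : Edge Λ → A
  kp1_idem : ∀ x, P x * P x = P x
  kp1_orth : ∀ x y, x ≠ y → P x * P y = 0
  kp2_mul : ∀ {x y z : Λ} (m : x ⟶ y) (l : y ⟶ z) (hm : deg m ≠ 0) (hl : deg l ≠ 0),
    S (Edge.of l hl) * S (Edge.of m hm) = S (Edge.of (m ≫ l) (deg_comp_ne_zero m l hl))
  kp2_mul_ghost : ∀ {x y z : Λ} (m : x ⟶ y) (l : y ⟶ z) (hm : deg m ≠ 0) (hl : deg l ≠ 0),
    S' (Edge.of m hm) * S' (Edge.of l hl) = S' (Edge.of (m ≫ l) (deg_comp_ne_zero m l hl))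
  kp2_range : ∀ l : Edge Λ, P l.1.range * S l = S l
  kp2_source : ∀ l : Edge Λ, S l * P l.1.source = S l
  kp2_range_ghost : ∀ l : Edge Λ, P l.1.source * S' l = S' l
  kp2_source_ghost : ∀ l : Edge Λ, S' l * P l.1.range = S' l
  kp3 : ∀ l m : Edge Λ, l.1.deg = m.1.deg → S' l * S m = if l = m then P l.1.source else 0
  kp4 : ∀ (x : Λ) (n : ℕ →₀ ℕ), n ≠ 0 →
    P x = ∑ᶠ l : {l : Edge Λ // l.1 ∈ pathsInto x n}, S l.1 * S' l.1

namespace KumjianPaskFamily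

variable {Λ : Type u} [NGraph.{u, v} Λ]

open scoped Classical in
/-- `s_l` for an arbitrary path `l`, with `s_x = p_x` for a vertex `x`. -/
noncomputable def path {A : Type w} [NonUnitalRing A] (F : KumjianPaskFamily Λ A)
    (l : Path Λ) : A :=
  if h : l.deg ≠ 0 then F.S ⟨l, h⟩ else F.P l.source

open scoped Classical in
/-- `s_{l^*}` for an arbitrary path `l`, with `s_{x^*} = p_x` for a vertex `x`. -/
noncomputable def ghost {A : Type w} [NonUnitalRing A] (F : KumjianPaskFamily Λ A)
    (l : Path Λ) : A :=
  if h : l.deg ≠ 0 then F.S' ⟨l, h⟩ else F.P l.source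

/-- The map `f` carries the family `F` to the family `G`. -/
def MapsTo {R : Type t} [CommRing R] {A B : Type*} [NonUnitalRing A] [Module R A]
    [NonUnitalRing B] [Module R B] (F : KumjianPaskFamily Λ A) (G : KumjianPaskFamily Λ B)
    (f : A →ₙₐ[R] B) : Prop :=
  (∀ x, f (F.P x) = G.P x) ∧ (∀ l, f (F.S l) = G.S l) ∧ (∀ l, f (F.S' l) = G.S' l)

variable (R : Type t) [CommRing R]

/-- The family generates the `R`-algebra `A`. -/
def Generates {A : Type w} [NonUnitalRing A] [Module R A] [IsScalarTower R A A]
    [SMulCommClass R A A] (F : KumjianPaskFamily Λ A) : Prop :=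
  NonUnitalAlgebra.adjoin R (Set.range F.P ∪ Set.range F.S ∪ Set.range F.S') = ⊤

/-- The universal property of a family `F` in an `R`-algebra `K`: for every family `G` in an
`R`-algebra `A` (in the universe `w`) there is a unique `R`-algebra homomorphism `K → A` that
carries `F` to `G`. -/
def IsUniversal {K : Type*} [NonUnitalRing K] [Module R K] (F : KumjianPaskFamily Λ K) : Prop :=
  ∀ (A : Type w) [NonUnitalRing A] [Module R A] [IsScalarTower R A A] [SMulCommClass R A A]
    (G : KumjianPaskFamily Λ A), ∃! f : K →ₙₐ[R] A, F.MapsTo G f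

/-- The `R`-span of the elements `s_a s_{b^*}` with `d(a) - d(b) = n`. -/
def component {A : Type w} [NonUnitalRing A] [Module R A] (F : KumjianPaskFamily Λ A)
    (n : ℕ →₀ ℤ) : Submodule R A :=
  Submodule.span R
    {c | ∃ a b : Path Λ, (∀ i, (a.deg i : ℤ) - (b.deg i : ℤ) = n i) ∧ c = F.path a * F.ghost b}

end KumjianPaskFamily

/-! Existence: divide the free unital algebra on vertices, nontrivial paths and ghost paths by the
Kumjian–Pask relations, and take the non-unital subalgebra generated by the images. A family in a
non-unital algebra `A` is first moved into `Unitization R A`; the resulting unital homomorphism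
sends the generated subalgebra into the ideal `A` (`exists_lift`). Generation makes the homomorphism
unique, and uniqueness of the algebra follows in the usual way.

Nonvanishing needs one family with `r • P x ≠ 0`. Paths act on `R`-valued functions on finite paths
by translation, ghost paths by inverse translation, vertices by restriction to a range. All
relations hold there except the fourth, which fails only at paths too short to factor; it becomes
true modulo functions that vanish at all sufficiently large degrees (`germFamily`). Without sources
the constant function `1`, restricted to paths with range `x`, survives in this quotient, even after
scaling by `r ≠ 0`.

Grading: to rewrite `s_{b^*} s_c`, expand the vertex idempotents at the sources so that both paths
are extended to the common degree `d(b) ⊔ d(c)`, where the third relation applies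
(`ghost_mul_path_mem_component`). Hence products respect degrees and the components span. They are
independent because the family twisted by degree, with values in a group algebra over `ℕ →₀ ℤ`,
induces a homomorphism that sends `a` of degree `n` to `a` placed at exponent `n`
(`MapsTo.twist_apply`), and coefficients separate the components. -/

namespace NGraph

variable {Λ : Type u} [NGraph.{u, v} Λ]

/-! ### Calculus of paths: composition, unique factorization, degrees. -/

namespace Path

/-- The vertex `x` as a path of degree zero. -/
def vertex (x : Λ) : Path Λ := ⟨x, x, 𝟙 x⟩

/-- The product `l m` of two composable paths. -/
def comp (l m : Path Λ) (h : m.range = l.source) : Path Λ :=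
  ⟨m.source, l.range, m.hom ≫ eqToHom h ≫ l.hom⟩

@[simp] theorem vertex_source (x : Λ) : (vertex x).source = x := rfl

@[simp] theorem vertex_range (x : Λ) : (vertex x).range = x := rfl

@[simp] theorem deg_vertex (x : Λ) : (vertex x).deg = 0 := deg_id x

@[simp] theorem comp_range (l m : Path Λ) (h : m.range = l.source) :
    (comp l m h).range = l.range := rfl

theorem comp_mk {x y z : Λ} (l : y ⟶ z) (m : x ⟶ y) :
    comp ⟨y, z, l⟩ ⟨x, y, m⟩ rfl = ⟨x, z, m ≫ l⟩ := by
  simp [comp]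

@[simp] theorem deg_comp (l m : Path Λ) (h : m.range = l.source) :
    (comp l m h).deg = l.deg + m.deg := by
  obtain ⟨x, y, m⟩ := m
  obtain ⟨y', z, l⟩ := l
  obtain rfl : y = y' := h
  rw [comp_mk]
  exact NGraph.deg_comp m l

theorem comp_assoc (k l m : Path Λ) (h : l.range = k.source) (h' : m.range = l.source) :
    comp (comp k l h) m h' = comp k (comp l m h') h := by
  simp [comp]

@[simp] theorem comp_vertex (l : Path Λ) : comp l (vertex l.source) rfl = l := by
  simp [comp, vertex]

@[simp] theorem vertex_comp (l : Path Λ) : comp (vertex l.range) l rfl = l := by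
  simp [comp, vertex]

theorem exists_eq_comp (p : Path Λ) {m n : ℕ →₀ ℕ} (h : p.deg = m + n) :
    ∃ (a b : Path Λ) (hab : b.range = a.source), a.deg = m ∧ b.deg = n ∧ comp a b hab = p := by
  obtain ⟨⟨y, a, b⟩, ⟨ha, hb, hab⟩, -⟩ := factorization p.hom m n h
  refine ⟨⟨y, p.range, a⟩, ⟨p.source, y, b⟩, rfl, ha, hb, ?_⟩
  rw [comp_mk]
  ext
  · rfl
  · rfl
  · exact heq_of_eq hab

/-- Uniqueness of factorization in the form used throughout. Only the first degrees need to be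
compared: those of the second factors then agree by cancellation in `ℕ →₀ ℕ`. -/
theorem comp_inj {a b a' b' : Path Λ} {h : b.range = a.source} {h' : b'.range = a'.source}
    (hd : a.deg = a'.deg) (he : comp a b h = comp a' b' h') : a = a' ∧ b = b' := by
  obtain ⟨x, y, b⟩ := b
  obtain ⟨y₁, z, a⟩ := a
  obtain rfl : y = y₁ := h
  obtain ⟨x', y', b'⟩ := b'
  obtain ⟨y₁', z', a'⟩ := a'
  obtain rfl : y' = y₁' := h'
  have hdeg := congrArg Path.deg he
  rw [deg_comp, deg_comp, hd] at hdeg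
  have hb := add_left_cancel hdeg
  rw [comp_mk, comp_mk, Path.mk.injEq] at he
  obtain ⟨rfl, rfl, he⟩ := he
  obtain ⟨q, -, hq⟩ := factorization (b ≫ a) (NGraph.deg a) (NGraph.deg b) (NGraph.deg_comp b a)
  have e := (hq ⟨y, a, b⟩ ⟨rfl, rfl, rfl⟩).trans
    (hq ⟨y', a', b'⟩ ⟨hd.symm, hb.symm, (eq_of_heq he).symm⟩).symm
  rw [Sigma.mk.injEq] at e
  obtain ⟨rfl, e⟩ := e
  obtain ⟨rfl, rfl⟩ := Prod.mk.inj (eq_of_heq e)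
  exact ⟨rfl, rfl⟩

/-- The path factors through its source vertex and through its range vertex; in degree zero both
factorizations have first factors of the same degree, so they coincide. -/
theorem eq_vertex_of_deg_eq_zero {l : Path Λ} (h : l.deg = 0) :
    l = vertex l.source ∧ l = vertex l.range := by
  have e : comp l (vertex l.source) rfl = comp (vertex l.range) l rfl := by simp
  obtain ⟨h₁, h₂⟩ := comp_inj (by simp [h]) e
  exact ⟨h₂.symm, h₁⟩

theorem source_eq_range_of_deg_eq_zero {l : Path Λ} (h : l.deg = 0) : l.source = l.range := by
  have := congrArg Path.source (eq_vertex_of_deg_eq_zero h).2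
  simpa using this

end Path

theorem pathsInto_zero (x : Λ) : pathsInto x 0 = {Path.vertex x} := by
  ext l
  constructor
  · rintro ⟨rfl, h⟩
    exact (Path.eq_vertex_of_deg_eq_zero h).2
  · rintro rfl
    exact ⟨rfl, Path.deg_vertex x⟩

/-- Makes the `finsum` in the fourth relation an actual finite sum, not the default value `0`. -/
theorem RowFinite.finite_edge (hfin : RowFinite Λ) (x : Λ) (n : ℕ →₀ ℕ) :
    Finite {l : Edge Λ // l.1 ∈ pathsInto x n} := by
  have := (hfin x n).to_subtype
  exact Finite.of_injective (β := pathsInto x n) (fun l => ⟨l.1.1, l.2⟩) fun a b h =>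
    Subtype.ext (Subtype.ext (Subtype.mk.inj h))

/-- The degree of a path as an integer sequence. -/
noncomputable def Path.intDeg (l : Path Λ) : ℕ →₀ ℤ := l.deg.mapRange Nat.cast Nat.cast_zero

@[simp] theorem Path.intDeg_apply (l : Path Λ) (i : ℕ) : l.intDeg i = l.deg i :=
  Finsupp.mapRange_apply ..

@[simp] theorem Path.intDeg_comp (l m : Path Λ) (h : m.range = l.source) :
    (comp l m h).intDeg = l.intDeg + m.intDeg := by
  ext i
  simp

theorem Path.intDeg_eq_zero {l : Path Λ} (h : l.deg = 0) : l.intDeg = 0 := by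
  ext i
  simp [h]

end NGraph

namespace KumjianPaskFamily

variable {Λ : Type u} [NGraph.{u, v} Λ]

/-! ### Relations for arbitrary paths, vertices included. -/

section Basic

variable {A : Type*} [NonUnitalRing A] (F : KumjianPaskFamily Λ A)

theorem path_of_deg_eq_zero {l : Path Λ} (h : l.deg = 0) : F.path l = F.P l.source := by
  simp [path, h]

theorem ghost_of_deg_eq_zero {l : Path Λ} (h : l.deg = 0) : F.ghost l = F.P l.source := by
  simp [ghost, h]

@[simp] theorem path_edge (l : Edge Λ) : F.path l.1 = F.S l := dif_pos l.2

@[simp] theorem ghost_edge (l : Edge Λ) : F.ghost l.1 = F.S' l := dif_pos l.2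

@[simp] theorem path_vertex (x : Λ) : F.path (Path.vertex x) = F.P x :=
  F.path_of_deg_eq_zero (Path.deg_vertex x)

@[simp] theorem ghost_vertex (x : Λ) : F.ghost (Path.vertex x) = F.P x :=
  F.ghost_of_deg_eq_zero (Path.deg_vertex x)

theorem range_mul_path (l : Path Λ) : F.P l.range * F.path l = F.path l := by
  by_cases h : l.deg = 0
  · rw [F.path_of_deg_eq_zero h, Path.source_eq_range_of_deg_eq_zero h, F.kp1_idem]
  · exact (F.path_edge ⟨l, h⟩).symm ▸ F.kp2_range ⟨l, h⟩

theorem path_mul_source (l : Path Λ) : F.path l * F.P l.source = F.path l := by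
  by_cases h : l.deg = 0
  · rw [F.path_of_deg_eq_zero h, F.kp1_idem]
  · exact (F.path_edge ⟨l, h⟩).symm ▸ F.kp2_source ⟨l, h⟩

theorem source_mul_ghost (l : Path Λ) : F.P l.source * F.ghost l = F.ghost l := by
  by_cases h : l.deg = 0
  · rw [F.ghost_of_deg_eq_zero h, F.kp1_idem]
  · exact (F.ghost_edge ⟨l, h⟩).symm ▸ F.kp2_range_ghost ⟨l, h⟩

theorem ghost_mul_range (l : Path Λ) : F.ghost l * F.P l.range = F.ghost l := by
  by_cases h : l.deg = 0
  · rw [F.ghost_of_deg_eq_zero h, Path.source_eq_range_of_deg_eq_zero h, F.kp1_idem]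
  · exact (F.ghost_edge ⟨l, h⟩).symm ▸ F.kp2_source_ghost ⟨l, h⟩

theorem path_mul_path (l m : Path Λ) (h : m.range = l.source) :
    F.path l * F.path m = F.path (l.comp m h) := by
  by_cases hl : l.deg = 0
  · obtain ⟨x, rfl⟩ : ∃ x, l = Path.vertex x := ⟨_, (Path.eq_vertex_of_deg_eq_zero hl).1⟩
    obtain rfl : m.range = x := h
    rw [path_vertex, range_mul_path, Path.vertex_comp]
  by_cases hm : m.deg = 0
  · obtain ⟨x, rfl⟩ : ∃ x, m = Path.vertex x := ⟨_, (Path.eq_vertex_of_deg_eq_zero hm).1⟩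
    obtain rfl : x = l.source := h
    rw [path_vertex, path_mul_source, Path.comp_vertex]
  obtain ⟨x, y, m⟩ := m
  obtain ⟨y', z, l⟩ := l
  obtain rfl : y = y' := h
  rw [Path.comp_mk]
  have := F.kp2_mul m l hm hl
  rw [← path_edge, ← path_edge, ← path_edge] at this
  exact this

theorem ghost_mul_ghost (l m : Path Λ) (h : m.range = l.source) :
    F.ghost m * F.ghost l = F.ghost (l.comp m h) := by
  by_cases hl : l.deg = 0
  · obtain ⟨x, rfl⟩ : ∃ x, l = Path.vertex x := ⟨_, (Path.eq_vertex_of_deg_eq_zero hl).1⟩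
    obtain rfl : m.range = x := h
    rw [ghost_vertex, ghost_mul_range, Path.vertex_comp]
  by_cases hm : m.deg = 0
  · obtain ⟨x, rfl⟩ : ∃ x, m = Path.vertex x := ⟨_, (Path.eq_vertex_of_deg_eq_zero hm).1⟩
    obtain rfl : x = l.source := h
    rw [ghost_vertex, source_mul_ghost, Path.comp_vertex]
  obtain ⟨x, y, m⟩ := m
  obtain ⟨y', z, l⟩ := l
  obtain rfl : y = y' := h
  rw [Path.comp_mk]
  have := F.kp2_mul_ghost m l hm hl
  rw [← ghost_edge, ← ghost_edge, ← ghost_edge] at this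
  exact this

theorem path_mul_path_of_ne (l m : Path Λ) (h : m.range ≠ l.source) :
    F.path l * F.path m = 0 := by
  rw [← F.path_mul_source l, ← F.range_mul_path m, mul_assoc, ← mul_assoc (F.P l.source),
    F.kp1_orth _ _ h.symm, zero_mul, mul_zero]

theorem ghost_mul_ghost_of_ne (l m : Path Λ) (h : m.range ≠ l.source) :
    F.ghost m * F.ghost l = 0 := by
  rw [← F.ghost_mul_range m, ← F.source_mul_ghost l, mul_assoc, ← mul_assoc (F.P m.range),
    F.kp1_orth _ _ h, zero_mul, mul_zero]

theorem ghost_mul_path_self (l : Path Λ) : F.ghost l * F.path l = F.P l.source := by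
  by_cases h : l.deg = 0
  · rw [F.path_of_deg_eq_zero h, F.ghost_of_deg_eq_zero h, F.kp1_idem]
  · have := (F.kp3 ⟨l, h⟩ ⟨l, h⟩ rfl).trans (if_pos rfl)
    unfold path ghost
    rwa [dif_pos h, dif_pos h]

theorem ghost_mul_path_of_ne {l m : Path Λ} (hd : l.deg = m.deg) (hne : l ≠ m) :
    F.ghost l * F.path m = 0 := by
  by_cases h : l.deg = 0
  · have hm := hd ▸ h
    rw [F.path_of_deg_eq_zero hm, F.ghost_of_deg_eq_zero h, F.kp1_orth]
    intro e
    exact hne <| by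
      rw [(Path.eq_vertex_of_deg_eq_zero h).1, (Path.eq_vertex_of_deg_eq_zero hm).1, e]
  · have := (F.kp3 ⟨l, h⟩ ⟨m, hd ▸ h⟩ hd).trans (if_neg fun e => hne (Subtype.mk.inj e))
    unfold path ghost
    rwa [dif_pos h, dif_pos (hd ▸ h)]

theorem P_eq_sum (hfin : RowFinite Λ) (x : Λ) (n : ℕ →₀ ℕ) :
    F.P x = ∑ l ∈ (hfin x n).toFinset, F.path l * F.ghost l := by
  by_cases hn : n = 0
  · subst hn
    have : (hfin x 0).toFinset = {Path.vertex x} := by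
      ext l
      simp [pathsInto_zero]
    rw [this, Finset.sum_singleton, path_vertex, ghost_vertex, F.kp1_idem]
  · have := hfin.finite_edge x n
    have := Fintype.ofFinite {l : Edge Λ // l.1 ∈ pathsInto x n}
    rw [F.kp4 x n hn, finsum_eq_sum_of_fintype]
    refine Finset.sum_bij (fun l _ => l.1.1) (fun l _ => by simpa using l.2)
      (fun a _ b _ h => Subtype.ext (Subtype.ext h)) (fun l hl => ?_) (fun l _ => by simp)
    have hl' : l ∈ pathsInto x n := by simpa using hl
    exact ⟨⟨⟨l, hl'.2 ▸ hn⟩, hl'⟩, Finset.mem_univ _, rfl⟩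

/-- The image of a family under a homomorphism. -/
def map (hfin : RowFinite Λ) {B : Type*} [NonUnitalRing B] (f : A →ₙ+* B) :
    KumjianPaskFamily Λ B where
  P x := f (F.P x)
  S l := f (F.S l)
  S' l := f (F.S' l)
  kp1_idem x := by rw [← map_mul, F.kp1_idem]
  kp1_orth x y h := by rw [← map_mul, F.kp1_orth x y h, map_zero]
  kp2_mul m l hm hl := by rw [← map_mul, F.kp2_mul]
  kp2_mul_ghost m l hm hl := by rw [← map_mul, F.kp2_mul_ghost]
  kp2_range l := by rw [← map_mul, F.kp2_range]
  kp2_source l := by rw [← map_mul, F.kp2_source]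
  kp2_range_ghost l := by rw [← map_mul, F.kp2_range_ghost]
  kp2_source_ghost l := by rw [← map_mul, F.kp2_source_ghost]
  kp3 l m h := by
    rw [← map_mul, F.kp3 l m h]
    split_ifs <;> simp
  kp4 x n hn := by
    have := hfin.finite_edge x n
    rw [F.kp4 x n hn, map_finsum f (Set.toFinite _)]
    simp

end Basic

/-! ### Products and span of the graded components. -/

section Grading

variable (R : Type t) [CommRing R] {A : Type*} [NonUnitalRing A] [Module R A]
  (F : KumjianPaskFamily Λ A)

theorem path_mul_ghost_mem_component {n : ℕ →₀ ℤ} (a b : Path Λ)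
    (h : a.intDeg - b.intDeg = n) : F.path a * F.ghost b ∈ F.component R n :=
  Submodule.subset_span ⟨a, b, fun i => by simp [← h], rfl⟩

theorem component_le {n : ℕ →₀ ℤ} {N : Submodule R A}
    (h : ∀ a b : Path Λ, a.intDeg - b.intDeg = n → F.path a * F.ghost b ∈ N) :
    F.component R n ≤ N := by
  refine Submodule.span_le.2 ?_
  rintro _ ⟨a, b, hab, rfl⟩
  exact h a b (Finsupp.ext fun i => by simpa using hab i)

theorem P_mem_component (x : Λ) : F.P x ∈ F.component R 0 := by
  have := F.path_mul_ghost_mem_component R (Path.vertex x) (Path.vertex x) (sub_self _)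
  simpa [F.kp1_idem] using this

theorem path_mem_component (l : Path Λ) : F.path l ∈ F.component R l.intDeg := by
  have := F.path_mul_ghost_mem_component R l (Path.vertex l.source)
    (n := l.intDeg) (by simp [Path.intDeg_eq_zero])
  simpa [F.path_mul_source] using this

theorem ghost_mem_component (l : Path Λ) : F.ghost l ∈ F.component R (-l.intDeg) := by
  have := F.path_mul_ghost_mem_component R (Path.vertex l.source) l
    (n := -l.intDeg) (by simp [Path.intDeg_eq_zero])
  simpa [F.source_mul_ghost] using this

variable [IsScalarTower R A A] [SMulCommClass R A A]

theorem path_mul_mul_ghost_mem_component {k n : ℕ →₀ ℤ} (a e : Path Λ) {x : A}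
    (hx : x ∈ F.component R k) (hn : a.intDeg + k - e.intDeg = n) :
    F.path a * x * F.ghost e ∈ F.component R n := by
  have : F.component R k ≤ (F.component R n).comap
      (LinearMap.mulRight R (F.ghost e) ∘ₗ LinearMap.mulLeft R (F.path a)) := by
    refine F.component_le R fun b c hbc => ?_
    change F.path a * (F.path b * F.ghost c) * F.ghost e ∈ F.component R n
    rw [← mul_assoc, mul_assoc]
    by_cases h₁ : b.range = a.source
    · by_cases h₂ : c.range = e.source
      · rw [F.path_mul_path _ _ h₁, F.ghost_mul_ghost _ _ h₂]
        refine F.path_mul_ghost_mem_component R _ _ ?_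
        rw [Path.intDeg_comp, Path.intDeg_comp, ← hn, ← hbc]
        abel
      · rw [F.ghost_mul_ghost_of_ne _ _ h₂, mul_zero]
        exact zero_mem _
    · rw [F.path_mul_path_of_ne _ _ h₁, zero_mul]
      exact zero_mem _
  exact this hx

theorem ghost_mul_path_mem_component (hfin : RowFinite Λ) {n : ℕ →₀ ℤ} (b c : Path Λ)
    (h : c.intDeg - b.intDeg = n) : F.ghost b * F.path c ∈ F.component R n := by
  -- Both source idempotents are inserted and expanded, each in the degree that its path lacks to
  -- reach `b.deg ⊔ c.deg`.
  rw [← F.source_mul_ghost b, ← F.path_mul_source c, mul_assoc, ← mul_assoc (F.ghost b),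
    ← mul_assoc, F.P_eq_sum hfin b.source (b.deg ⊔ c.deg - b.deg),
    F.P_eq_sum hfin c.source (b.deg ⊔ c.deg - c.deg), Finset.sum_mul, Finset.sum_mul_sum]
  refine sum_mem fun l hl => sum_mem fun m hm => ?_
  obtain ⟨hlr, hld⟩ : l.range = b.source ∧ l.deg = _ := by simpa [pathsInto] using hl
  obtain ⟨hmr, hmd⟩ : m.range = c.source ∧ m.deg = _ := by simpa [pathsInto] using hm
  have e : F.path l * F.ghost l * (F.ghost b * F.path c) * (F.path m * F.ghost m) =
      F.path l * (F.ghost (b.comp l hlr) * F.path (c.comp m hmr)) * F.ghost m := by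
    rw [← F.path_mul_path, ← F.ghost_mul_ghost]
    simp only [mul_assoc]
  have hbl : b.deg + l.deg = b.deg ⊔ c.deg := by rw [hld, add_tsub_cancel_of_le le_sup_left]
  have hcm : c.deg + m.deg = b.deg ⊔ c.deg := by rw [hmd, add_tsub_cancel_of_le le_sup_right]
  have key : F.path l * (F.ghost (b.comp l hlr) * F.path (c.comp m hmr)) * F.ghost m ∈
      F.component R n := by
    -- The two extended paths have equal degree, so the inner product is a vertex idempotent or
    -- zero. In the first case `d(b) + d(l) = d(c) + d(m)` gives `d(l) - d(m) = d(c) - d(b)`.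
    by_cases heq : b.comp l hlr = c.comp m hmr
    · rw [heq, F.ghost_mul_path_self]
      refine F.path_mul_mul_ghost_mem_component R l m (F.P_mem_component R _) ?_
      ext i
      have := DFunLike.congr_fun (hbl.trans hcm.symm) i
      simp [← h] at this ⊢
      lia
    · rw [F.ghost_mul_path_of_ne (by simp [hbl, hcm]) heq, mul_zero, zero_mul]
      exact zero_mem _
  rw [← e] at key
  simpa only [mul_assoc] using key

theorem mul_mem_component (hfin : RowFinite Λ) (m n : ℕ →₀ ℤ) {a b : A}
    (ha : a ∈ F.component R m) (hb : b ∈ F.component R n) : a * b ∈ F.component R (m + n) := by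
  have h₁ : F.component R m ≤ (F.component R (m + n)).comap (LinearMap.mulRight R b) := by
    refine F.component_le R fun a c hac => ?_
    have h₂ : F.component R n ≤
        (F.component R (m + n)).comap (LinearMap.mulLeft R (F.path a * F.ghost c)) := by
      refine F.component_le R fun d e hde => ?_
      change F.path a * F.ghost c * (F.path d * F.ghost e) ∈ F.component R (m + n)
      rw [← mul_assoc, mul_assoc (F.path a)]
      refine F.path_mul_mul_ghost_mem_component R a e
        (F.ghost_mul_path_mem_component R hfin c d rfl) ?_
      rw [← hac, ← hde]
      abel
    exact h₂ hb
  exact h₁ ha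

/-- By multiplicativity the sum of the components is a subalgebra, and it contains every generator.
-/
theorem iSup_component_eq_top (hfin : RowFinite Λ) (hgen : F.Generates R) :
    ⨆ n, F.component R n = ⊤ := by
  let N : NonUnitalSubalgebra R A :=
    { (⨆ n, F.component R n : Submodule R A) with
      mul_mem' := by
        intro a b ha hb
        have h₁ : (⨆ n, F.component R n) ≤
            (⨆ n, F.component R n).comap (LinearMap.mulRight R b) := by
          refine iSup_le fun m a ha => ?_
          have h₂ : (⨆ n, F.component R n) ≤
              (⨆ n, F.component R n).comap (LinearMap.mulLeft R a) :=
            iSup_le fun n b hb =>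
              Submodule.mem_iSup_of_mem (m + n) (F.mul_mem_component R hfin m n ha hb)
          exact h₂ hb
        exact h₁ ha }
  have hN : NonUnitalAlgebra.adjoin R (Set.range F.P ∪ Set.range F.S ∪ Set.range F.S') ≤ N := by
    refine NonUnitalAlgebra.adjoin_le ?_
    rintro _ ((⟨x, rfl⟩ | ⟨l, rfl⟩) | ⟨l, rfl⟩)
    · exact Submodule.mem_iSup_of_mem _ (F.P_mem_component R x)
    · rw [← path_edge]
      exact Submodule.mem_iSup_of_mem _ (F.path_mem_component R l.1)
    · rw [← ghost_edge]
      exact Submodule.mem_iSup_of_mem _ (F.ghost_mem_component R l.1)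
  refine eq_top_iff.2 fun x _ => hN ?_
  rw [hgen]
  trivial

end Grading

end KumjianPaskFamily

/-! ### A concrete representation on germs of functions on paths. -/

namespace NGraph

variable {Λ : Type u} [NGraph.{u, v} Λ] (R : Type t) [CommRing R]

/-- Restriction of a function on paths to the paths with range `x`. -/
noncomputable def restrictRange (x : Λ) : Module.End R (Path Λ → R) :=
  open scoped Classical in
  { toFun := fun f p => if p.range = x then f p else 0
    map_add' := fun f g => by ext p; by_cases h : p.range = x <;> simp [h]
    map_smul' := fun r f => by ext p; by_cases h : p.range = x <;> simp [h] }

/-- Translation of a function on paths along `l`: the value of `f` at `m` is moved to `l m`. -/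
noncomputable def prepend (l : Path Λ) : Module.End R (Path Λ → R) :=
  open scoped Classical in
  { toFun := fun f p => if h : ∃ m, ∃ hm : m.range = l.source, l.comp m hm = p
      then f h.choose else 0
    map_add' := fun f g => by
      ext p
      by_cases h : ∃ m, ∃ hm : m.range = l.source, l.comp m hm = p <;> simp [h]
    map_smul' := fun r f => by
      ext p
      by_cases h : ∃ m, ∃ hm : m.range = l.source, l.comp m hm = p <;> simp [h] }

/-- The inverse translation along `l`: the value of `f` at `l m` is moved to `m`. -/
noncomputable def unprepend (l : Path Λ) : Module.End R (Path Λ → R) :=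
  open scoped Classical in
  { toFun := fun f p => if h : p.range = l.source then f (l.comp p h) else 0
    map_add' := fun f g => by ext p; by_cases h : p.range = l.source <;> simp [h]
    map_smul' := fun r f => by ext p; by_cases h : p.range = l.source <;> simp [h] }

variable {R}

theorem restrictRange_of_eq {x : Λ} (f : Path Λ → R) {p : Path Λ} (h : p.range = x) :
    restrictRange R x f p = f p := if_pos h

theorem restrictRange_of_ne {x : Λ} (f : Path Λ → R) {p : Path Λ} (h : p.range ≠ x) :
    restrictRange R x f p = 0 := if_neg h

/-- The chosen preimage in `prepend` does not matter, since composition with `l` on the left is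
injective. -/
theorem prepend_comp (l m : Path Λ) (h : m.range = l.source) (f : Path Λ → R) :
    prepend R l f (l.comp m h) = f m := by
  have hex : ∃ m', ∃ hm : m'.range = l.source, l.comp m' hm = l.comp m h := ⟨m, h, rfl⟩
  refine (dif_pos hex).trans ?_
  obtain ⟨_, h₂⟩ := hex.choose_spec
  rw [(Path.comp_inj rfl h₂).2]

theorem prepend_of_not {l p : Path Λ} (h : ¬∃ m, ∃ hm : m.range = l.source, l.comp m hm = p)
    (f : Path Λ → R) : prepend R l f p = 0 := dif_neg h

theorem unprepend_of_eq {l p : Path Λ} (h : p.range = l.source) (f : Path Λ → R) :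
    unprepend R l f p = f (l.comp p h) := dif_pos h

theorem unprepend_of_ne {l p : Path Λ} (h : p.range ≠ l.source) (f : Path Λ → R) :
    unprepend R l f p = 0 := dif_neg h

variable (Λ R)

/-- The functions on paths that vanish on all paths of sufficiently large degree. -/
def eventuallyZero : Submodule R (Path Λ → R) where
  carrier := {f | ∃ n, ∀ p : Path Λ, n ≤ p.deg → f p = 0}
  zero_mem' := ⟨0, fun _ _ => rfl⟩
  add_mem' := by
    rintro f g ⟨m, hm⟩ ⟨n, hn⟩
    refine ⟨m ⊔ n, fun p hp => ?_⟩
    simp [hm p (le_sup_left.trans hp), hn p (le_sup_right.trans hp)]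
  smul_mem' := by
    rintro r f ⟨n, hn⟩
    exact ⟨n, fun p hp => by simp [hn p hp]⟩

/-- Germs of functions on paths at infinite degree. -/
abbrev Germs : Type (max u v t) := (Path Λ → R) ⧸ eventuallyZero Λ R

variable {Λ R}

theorem eventuallyZero_le_comap_restrictRange (x : Λ) :
    eventuallyZero Λ R ≤ (eventuallyZero Λ R).comap (restrictRange R x) := by
  rintro f ⟨n, hn⟩
  refine ⟨n, fun p hp => ?_⟩
  by_cases h : p.range = x
  · rw [restrictRange_of_eq f h, hn p hp]
  · exact restrictRange_of_ne f h

theorem eventuallyZero_le_comap_prepend (l : Path Λ) :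
    eventuallyZero Λ R ≤ (eventuallyZero Λ R).comap (prepend R l) := by
  rintro f ⟨n, hn⟩
  -- Translation along `l` raises degrees by `l.deg`, so the bound moves with it.
  refine ⟨l.deg + n, fun p hp => ?_⟩
  by_cases h : ∃ m, ∃ hm : m.range = l.source, l.comp m hm = p
  · obtain ⟨m, hm, rfl⟩ := h
    rw [prepend_comp, hn m]
    rw [Path.deg_comp] at hp
    exact le_of_add_le_add_left hp
  · exact prepend_of_not h f

theorem eventuallyZero_le_comap_unprepend (l : Path Λ) :
    eventuallyZero Λ R ≤ (eventuallyZero Λ R).comap (unprepend R l) := by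
  rintro f ⟨n, hn⟩
  refine ⟨n, fun p hp => ?_⟩
  by_cases h : p.range = l.source
  · rw [unprepend_of_eq h, hn]
    rw [Path.deg_comp]
    exact hp.trans le_add_self
  · exact unprepend_of_ne h f

variable (R)

theorem restrictRange_mul_self (x : Λ) :
    restrictRange R x * restrictRange R x = restrictRange R x := by
  ext1 f
  ext p
  change restrictRange R x (restrictRange R x f) p = _
  by_cases h : p.range = x
  · rw [restrictRange_of_eq _ h]
  · rw [restrictRange_of_ne _ h, restrictRange_of_ne _ h]

theorem restrictRange_mul_of_ne {x y : Λ} (hxy : x ≠ y) :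
    restrictRange R x * restrictRange R y = 0 := by
  ext1 f
  ext p
  change restrictRange R x (restrictRange R y f) p = 0
  by_cases h : p.range = x
  · rw [restrictRange_of_eq _ h, restrictRange_of_ne]
    exact fun e => hxy (h.symm.trans e)
  · rw [restrictRange_of_ne _ h]

theorem prepend_mul_prepend (l m : Path Λ) (h : m.range = l.source) :
    prepend R l * prepend R m = prepend R (l.comp m h) := by
  ext1 f
  ext p
  change prepend R l (prepend R m f) p = _
  by_cases hp : ∃ q, ∃ hq : q.range = l.source, l.comp q hq = p
  · obtain ⟨q, hq, rfl⟩ := hp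
    rw [prepend_comp]
    by_cases hq' : ∃ r, ∃ hr : r.range = m.source, m.comp r hr = q
    · obtain ⟨r, hr, rfl⟩ := hq'
      rw [prepend_comp]
      exact ((congrArg (prepend R (l.comp m h) f) (Path.comp_assoc l m r h hr)).symm.trans
        (prepend_comp (l.comp m h) r hr f)).symm
    · rw [prepend_of_not hq', prepend_of_not]
      rintro ⟨r, hr, e⟩
      exact hq' ⟨r, hr, (Path.comp_inj rfl ((Path.comp_assoc l m r h hr).symm.trans e)).2⟩
  · rw [prepend_of_not hp, prepend_of_not]
    rintro ⟨r, hr, e⟩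
    exact hp ⟨_, _, (Path.comp_assoc l m r h hr).symm.trans e⟩

theorem unprepend_mul_unprepend (l m : Path Λ) (h : m.range = l.source) :
    unprepend R m * unprepend R l = unprepend R (l.comp m h) := by
  ext1 f
  ext p
  change unprepend R m (unprepend R l f) p = _
  by_cases hp : p.range = m.source
  · rw [unprepend_of_eq hp, unprepend_of_eq (show (m.comp p hp).range = l.source from h),
      unprepend_of_eq (show p.range = (l.comp m h).source from hp), Path.comp_assoc]
  · rw [unprepend_of_ne hp, unprepend_of_ne (show p.range ≠ (l.comp m h).source from hp)]

theorem restrictRange_mul_prepend (l : Path Λ) :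
    restrictRange R l.range * prepend R l = prepend R l := by
  ext1 f
  ext p
  change restrictRange R l.range (prepend R l f) p = _
  by_cases h : p.range = l.range
  · rw [restrictRange_of_eq _ h]
  · rw [restrictRange_of_ne _ h, prepend_of_not]
    rintro ⟨m, hm, rfl⟩
    exact h rfl

theorem prepend_mul_restrictRange (l : Path Λ) :
    prepend R l * restrictRange R l.source = prepend R l := by
  ext1 f
  ext p
  change prepend R l (restrictRange R l.source f) p = _
  by_cases h : ∃ q, ∃ hq : q.range = l.source, l.comp q hq = p
  · obtain ⟨q, hq, rfl⟩ := h
    rw [prepend_comp, prepend_comp, restrictRange_of_eq _ hq]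
  · rw [prepend_of_not h, prepend_of_not h]

theorem restrictRange_mul_unprepend (l : Path Λ) :
    restrictRange R l.source * unprepend R l = unprepend R l := by
  ext1 f
  ext p
  change restrictRange R l.source (unprepend R l f) p = _
  by_cases h : p.range = l.source
  · rw [restrictRange_of_eq _ h]
  · rw [restrictRange_of_ne _ h, unprepend_of_ne h]

theorem unprepend_mul_restrictRange (l : Path Λ) :
    unprepend R l * restrictRange R l.range = unprepend R l := by
  ext1 f
  ext p
  change unprepend R l (restrictRange R l.range f) p = _
  by_cases h : p.range = l.source
  · rw [unprepend_of_eq h, unprepend_of_eq h, restrictRange_of_eq _ (Path.comp_range _ _ _)]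
  · rw [unprepend_of_ne h, unprepend_of_ne h]

theorem unprepend_mul_prepend_self (l : Path Λ) :
    unprepend R l * prepend R l = restrictRange R l.source := by
  ext1 f
  ext p
  change unprepend R l (prepend R l f) p = _
  by_cases h : p.range = l.source
  · rw [unprepend_of_eq h, prepend_comp, restrictRange_of_eq _ h]
  · rw [unprepend_of_ne h, restrictRange_of_ne _ h]

/-- A path has only one initial segment of a given degree. -/
theorem unprepend_mul_prepend_of_ne {l m : Path Λ} (hd : l.deg = m.deg) (hne : l ≠ m) :
    unprepend R l * prepend R m = 0 := by
  ext1 f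
  ext p
  change unprepend R l (prepend R m f) p = 0
  by_cases h : p.range = l.source
  · rw [unprepend_of_eq h, prepend_of_not]
    rintro ⟨q, hq, e⟩
    exact hne (Path.comp_inj hd.symm e).1.symm
  · rw [unprepend_of_ne h]

/-- Every path of degree at least `n` starts with exactly one path of degree `n`. -/
theorem sum_prepend_unprepend_apply (hfin : RowFinite Λ) (x : Λ) (n : ℕ →₀ ℕ) (f : Path Λ → R)
    (p : Path Λ) (hp : n ≤ p.deg) :
    ∑ l ∈ (hfin x n).toFinset, prepend R l (unprepend R l f) p = restrictRange R x f p := by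
  obtain ⟨a, b, hab, ha, -, rfl⟩ := Path.exists_eq_comp p (add_tsub_cancel_of_le hp).symm
  have hzero : ∀ l ∈ (hfin x n).toFinset, l ≠ a →
      prepend R l (unprepend R l f) (a.comp b hab) = 0 := by
    intro l hl hne
    have hl' : l.range = x ∧ l.deg = n := by simpa [pathsInto] using hl
    rw [prepend_of_not]
    rintro ⟨q, hq, e⟩
    exact hne (Path.comp_inj (hl'.2.trans ha.symm) e).1
  by_cases hx : a.range = x
  · rw [restrictRange_of_eq _ (show (a.comp b hab).range = x from hx),
      Finset.sum_eq_single a hzero, prepend_comp, unprepend_of_eq]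
    intro h
    exact absurd (by simpa [pathsInto] using ⟨hx, ha⟩) h
  · rw [restrictRange_of_ne _ (show (a.comp b hab).range ≠ x from hx)]
    refine Finset.sum_eq_zero fun l hl => hzero l hl ?_
    rintro rfl
    have hl' : l.range = x ∧ l.deg = n := by simpa [pathsInto] using hl
    exact hx hl'.1

variable {R}

theorem mapQ_mul_mapQ {M : Type*} [AddCommGroup M] [Module R M] {N : Submodule R M}
    {S T U : Module.End R M} (hS : N ≤ N.comap S) (hT : N ≤ N.comap T) (hU : N ≤ N.comap U)
    (h : S * T = U) : (N.mapQ N S hS * N.mapQ N T hT : Module.End R (M ⧸ N)) = N.mapQ N U hU := by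
  subst h
  exact (N.mapQ_comp N N T S hT hS).symm

theorem mapQ_mul_mapQ_eq_zero {M : Type*} [AddCommGroup M] [Module R M] {N : Submodule R M}
    {S T : Module.End R M} (hS : N ≤ N.comap S) (hT : N ≤ N.comap T) (h : S * T = 0) :
    (N.mapQ N S hS * N.mapQ N T hT : Module.End R (M ⧸ N)) = 0 :=
  (mapQ_mul_mapQ (U := 0) hS hT (fun _ _ => N.zero_mem) h).trans (N.mapQ_zero N)

variable (R)

/-- The Kumjian–Pask family of translation operators on germs of functions on paths. -/
noncomputable def germFamily (hfin : RowFinite Λ) :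
    KumjianPaskFamily Λ (Module.End R (Germs Λ R)) where
  P x := (eventuallyZero Λ R).mapQ _ (restrictRange R x) (eventuallyZero_le_comap_restrictRange x)
  S l := (eventuallyZero Λ R).mapQ _ (prepend R l.1) (eventuallyZero_le_comap_prepend l.1)
  S' l := (eventuallyZero Λ R).mapQ _ (unprepend R l.1) (eventuallyZero_le_comap_unprepend l.1)
  kp1_idem x := mapQ_mul_mapQ _ _ _ (restrictRange_mul_self R x)
  kp1_orth x y h := mapQ_mul_mapQ_eq_zero _ _ (restrictRange_mul_of_ne R h)
  kp2_mul {x y z} m l hm hl := by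
    refine mapQ_mul_mapQ _ _ _ ?_
    have := prepend_mul_prepend R (⟨y, z, l⟩ : Path Λ) ⟨x, y, m⟩ rfl
    rwa [Path.comp_mk] at this
  kp2_mul_ghost {x y z} m l hm hl := by
    refine mapQ_mul_mapQ _ _ _ ?_
    have := unprepend_mul_unprepend R (⟨y, z, l⟩ : Path Λ) ⟨x, y, m⟩ rfl
    rwa [Path.comp_mk] at this
  kp2_range l := mapQ_mul_mapQ _ _ _ (restrictRange_mul_prepend R l.1)
  kp2_source l := mapQ_mul_mapQ _ _ _ (prepend_mul_restrictRange R l.1)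
  kp2_range_ghost l := mapQ_mul_mapQ _ _ _ (restrictRange_mul_unprepend R l.1)
  kp2_source_ghost l := mapQ_mul_mapQ _ _ _ (unprepend_mul_restrictRange R l.1)
  kp3 l m hd := by
    split_ifs with h
    · subst h
      exact mapQ_mul_mapQ _ _ _ (unprepend_mul_prepend_self R l.1)
    · exact mapQ_mul_mapQ_eq_zero _ _ (unprepend_mul_prepend_of_ne R hd
        fun e => h (Subtype.ext e))
  kp4 x n hn := by
    have := hfin.finite_edge x n
    have := Fintype.ofFinite {l : Edge Λ // l.1 ∈ pathsInto x n}
    rw [finsum_eq_sum_of_fintype]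
    refine Submodule.linearMap_qext _ (LinearMap.ext fun f => ?_)
    rw [LinearMap.comp_apply, LinearMap.comp_apply, LinearMap.sum_apply]
    refine Eq.trans (b := (eventuallyZero Λ R).mkQ (restrictRange R x f)) rfl (Eq.trans ?_
      (map_sum (eventuallyZero Λ R).mkQ
        (fun l : {l : Edge Λ // l.1 ∈ pathsInto x n} => prepend R l.1.1 (unprepend R l.1.1 f)) _))
    rw [← sub_eq_zero, ← map_sub, Submodule.mkQ_apply, Submodule.Quotient.mk_eq_zero]
    -- The fourth relation holds pointwise only at paths of degree at least `n`, which is all that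
    -- equality of germs requires.
    refine ⟨n, fun p hp => ?_⟩
    rw [Pi.sub_apply, ← sum_prepend_unprepend_apply R hfin x n f p hp, Finset.sum_apply,
      sub_eq_zero]
    refine (Finset.sum_bij (fun l _ => l.1.1) (fun l _ => by simpa using l.2)
      (fun a _ b _ h => Subtype.ext (Subtype.ext h)) (fun l hl => ?_) (fun l _ => rfl)).symm
    have hl' : l ∈ pathsInto x n := by simpa using hl
    exact ⟨⟨⟨l, hl'.2 ▸ hn⟩, hl'⟩, @Finset.mem_univ _ this _, rfl⟩

theorem smul_germFamily_P_ne_zero (hfin : RowFinite Λ) (hsrc : NoSources Λ) {r : R} (hr : r ≠ 0)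
    (x : Λ) : r • (germFamily R hfin).P x ≠ 0 := by
  intro h
  have h₁ : r • (eventuallyZero Λ R).mkQ (restrictRange R x fun _ => 1) = 0 :=
    -- Testing on the constant function `1`: whatever bound `n` is claimed, a path of degree `n`
    -- into `x` carries the value `r`.
    LinearMap.congr_fun h ((eventuallyZero Λ R).mkQ fun _ => 1)
  rw [← map_smul, Submodule.mkQ_apply, Submodule.Quotient.mk_eq_zero] at h₁
  obtain ⟨n, hn⟩ := h₁
  obtain ⟨p, hp, hd⟩ := hsrc x n
  have h₂ := hn p hd.ge
  rw [Pi.smul_apply, restrictRange_of_eq _ hp, smul_eq_mul, mul_one] at h₂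
  exact hr h₂

end NGraph

namespace KumjianPaskFamily

variable {Λ : Type u} [NGraph.{u, v} Λ]

/-! ### Homomorphisms and generation. -/

section Hom

variable {R : Type t} [CommRing R] {A : Type*} [NonUnitalRing A] [Module R A]
  {B : Type*} [NonUnitalRing B] [Module R B]
  {F : KumjianPaskFamily Λ A} {G : KumjianPaskFamily Λ B}

theorem MapsTo.path {f : A →ₙₐ[R] B} (hf : F.MapsTo G f) (l : Path Λ) :
    f (F.path l) = G.path l := by
  unfold KumjianPaskFamily.path
  split_ifs
  · exact hf.2.1 _
  · exact hf.1 _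

theorem MapsTo.ghost {f : A →ₙₐ[R] B} (hf : F.MapsTo G f) (l : Path Λ) :
    f (F.ghost l) = G.ghost l := by
  unfold KumjianPaskFamily.ghost
  split_ifs
  · exact hf.2.2 _
  · exact hf.1 _

theorem Generates.surjective [IsScalarTower R B B] [SMulCommClass R B B] (hG : G.Generates R)
    {f : A →ₙₐ[R] B} (hf : F.MapsTo G f) : Function.Surjective f := by
  intro b
  have hb : b ∈ NonUnitalAlgebra.adjoin R (Set.range G.P ∪ Set.range G.S ∪ Set.range G.S') := by
    rw [hG]
    trivial
  have hle : NonUnitalAlgebra.adjoin R (Set.range G.P ∪ Set.range G.S ∪ Set.range G.S') ≤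
      NonUnitalAlgHom.range f := by
    refine NonUnitalAlgebra.adjoin_le ?_
    rintro _ ((⟨x, rfl⟩ | ⟨l, rfl⟩) | ⟨l, rfl⟩)
    · exact ⟨_, hf.1 x⟩
    · exact ⟨_, hf.2.1 l⟩
    · exact ⟨_, hf.2.2 l⟩
  exact hle hb

variable [IsScalarTower R A A] [SMulCommClass R A A]

theorem Generates.hom_ext (hF : F.Generates R) {f g : A →ₙₐ[R] B} (hf : F.MapsTo G f)
    (hg : F.MapsTo G g) : f = g := by
  ext a
  have ha : a ∈ NonUnitalAlgebra.adjoin R (Set.range F.P ∪ Set.range F.S ∪ Set.range F.S') := by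
    rw [hF]
    trivial
  induction ha using NonUnitalAlgebra.adjoin_induction with
  | mem x hx =>
    obtain ((⟨x, rfl⟩ | ⟨l, rfl⟩) | ⟨l, rfl⟩) := hx
    · rw [hf.1, hg.1]
    · rw [hf.2.1, hg.2.1]
    · rw [hf.2.2, hg.2.2]
  | zero => simp
  | add x y _ _ hx hy => simp [hx, hy]
  | mul x y _ _ hx hy => simp [hx, hy]
  | smul r x _ hx => simp [hx]

end Hom

/-! ### Passing to the generated subalgebra. -/

section Restrict

variable {R : Type t} [CommRing R] {A : Type*} [NonUnitalRing A] [Module R A]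
  [IsScalarTower R A A] [SMulCommClass R A A] (F : KumjianPaskFamily Λ A)

variable (R) in
/-- The subalgebra generated by a family. -/
abbrev generated : NonUnitalSubalgebra R A :=
  NonUnitalAlgebra.adjoin R (Set.range F.P ∪ Set.range F.S ∪ Set.range F.S')

theorem P_mem_generated (x : Λ) : F.P x ∈ F.generated R :=
  NonUnitalAlgebra.subset_adjoin R (.inl (.inl ⟨x, rfl⟩))

theorem S_mem_generated (l : Edge Λ) : F.S l ∈ F.generated R :=
  NonUnitalAlgebra.subset_adjoin R (.inl (.inr ⟨l, rfl⟩))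

theorem S'_mem_generated (l : Edge Λ) : F.S' l ∈ F.generated R :=
  NonUnitalAlgebra.subset_adjoin R (.inr ⟨l, rfl⟩)

variable (R) in
/-- A family, regarded as a family in the subalgebra that it generates. -/
def toGenerated (hfin : RowFinite Λ) : KumjianPaskFamily Λ (F.generated R) where
  P x := ⟨F.P x, F.P_mem_generated x⟩
  S l := ⟨F.S l, F.S_mem_generated l⟩
  S' l := ⟨F.S' l, F.S'_mem_generated l⟩
  kp1_idem x := Subtype.ext (F.kp1_idem x)
  kp1_orth x y h := Subtype.ext (F.kp1_orth x y h)
  kp2_mul m l hm hl := Subtype.ext (F.kp2_mul m l hm hl)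
  kp2_mul_ghost m l hm hl := Subtype.ext (F.kp2_mul_ghost m l hm hl)
  kp2_range l := Subtype.ext (F.kp2_range l)
  kp2_source l := Subtype.ext (F.kp2_source l)
  kp2_range_ghost l := Subtype.ext (F.kp2_range_ghost l)
  kp2_source_ghost l := Subtype.ext (F.kp2_source_ghost l)
  kp3 l m h := by
    refine Subtype.ext ((F.kp3 l m h).trans ?_)
    split_ifs <;> rfl
  kp4 x n hn := by
    have := hfin.finite_edge x n
    refine Subtype.ext ((F.kp4 x n hn).trans ?_)
    exact (map_finsum (NonUnitalSubalgebraClass.subtype (F.generated R))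
      (f := fun l : {l : Edge Λ // l.1 ∈ pathsInto x n} =>
        (⟨F.S l.1, F.S_mem_generated l.1⟩ * ⟨F.S' l.1, F.S'_mem_generated l.1⟩ : F.generated R))
      (Set.toFinite _)).symm

theorem toGenerated_generates (hfin : RowFinite Λ) : (F.toGenerated R hfin).Generates R := by
  refine eq_top_iff.2 ?_
  rintro ⟨a, ha⟩ -
  induction ha using NonUnitalAlgebra.adjoin_induction with
  | mem x hx =>
    refine NonUnitalAlgebra.subset_adjoin R ?_
    obtain ((⟨x, rfl⟩ | ⟨l, rfl⟩) | ⟨l, rfl⟩) := hx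
    · exact .inl (.inl ⟨x, rfl⟩)
    · exact .inl (.inr ⟨l, rfl⟩)
    · exact .inr ⟨l, rfl⟩
  | zero => exact zero_mem _
  | add x y _ _ hx hy => exact add_mem hx hy
  | mul x y _ _ hx hy => exact mul_mem hx hy
  | smul r x _ hx => exact SMulMemClass.smul_mem r hx

end Restrict

/-! ### Construction of the universal algebra. -/

section Universal

variable (Λ) (R : Type t) [CommRing R]

/-- The free unital algebra on the vertices, the nontrivial paths and the nontrivial ghost
paths. -/
abbrev FreeAlg : Type (max u v t) := FreeAlgebra R (Λ ⊕ Edge Λ ⊕ Edge Λ)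

variable {Λ}

/-- The generator of the free algebra for a vertex. -/
def freeP (x : Λ) : FreeAlg Λ R := FreeAlgebra.ι R (.inl x)

/-- The generator of the free algebra for a nontrivial path. -/
def freeS (l : Edge Λ) : FreeAlg Λ R := FreeAlgebra.ι R (.inr (.inl l))

/-- The generator of the free algebra for a nontrivial ghost path. -/
def freeS' (l : Edge Λ) : FreeAlg Λ R := FreeAlgebra.ι R (.inr (.inr l))

/-- The Kumjian–Pask relations. -/
inductive Rel : FreeAlg Λ R → FreeAlg Λ R → Prop
  | idem (x : Λ) : Rel (freeP R x * freeP R x) (freeP R x)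
  | orth (x y : Λ) (h : x ≠ y) : Rel (freeP R x * freeP R y) 0
  | path_mul {x y z : Λ} (m : x ⟶ y) (l : y ⟶ z) (hm : deg m ≠ 0) (hl : deg l ≠ 0) :
      Rel (freeS R (Edge.of l hl) * freeS R (Edge.of m hm))
        (freeS R (Edge.of (m ≫ l) (deg_comp_ne_zero m l hl)))
  | ghost_mul {x y z : Λ} (m : x ⟶ y) (l : y ⟶ z) (hm : deg m ≠ 0) (hl : deg l ≠ 0) :
      Rel (freeS' R (Edge.of m hm) * freeS' R (Edge.of l hl))
        (freeS' R (Edge.of (m ≫ l) (deg_comp_ne_zero m l hl)))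
  | range_mul (l : Edge Λ) : Rel (freeP R l.1.range * freeS R l) (freeS R l)
  | mul_source (l : Edge Λ) : Rel (freeS R l * freeP R l.1.source) (freeS R l)
  | source_mul (l : Edge Λ) : Rel (freeP R l.1.source * freeS' R l) (freeS' R l)
  | mul_range (l : Edge Λ) : Rel (freeS' R l * freeP R l.1.range) (freeS' R l)
  | ghost_path_self (l : Edge Λ) : Rel (freeS' R l * freeS R l) (freeP R l.1.source)
  | ghost_path_of_ne (l m : Edge Λ) (hd : l.1.deg = m.1.deg) (h : l ≠ m) :
      Rel (freeS' R l * freeS R m) 0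
  | sum (x : Λ) (n : ℕ →₀ ℕ) (hn : n ≠ 0) :
      Rel (freeP R x) (∑ᶠ l : {l : Edge Λ // l.1 ∈ pathsInto x n}, freeS R l.1 * freeS' R l.1)

variable (Λ) in
/-- The universal unital algebra for the Kumjian–Pask relations. -/
abbrev UnitalAlg : Type (max u v t) := RingQuot (Rel (Λ := Λ) R)

/-- The Kumjian–Pask family in the universal unital algebra. -/
noncomputable def unitalFamily (hfin : RowFinite Λ) : KumjianPaskFamily Λ (UnitalAlg Λ R) where
  P x := RingQuot.mkAlgHom R (Rel R) (freeP R x)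
  S l := RingQuot.mkAlgHom R (Rel R) (freeS R l)
  S' l := RingQuot.mkAlgHom R (Rel R) (freeS' R l)
  kp1_idem x := by rw [← map_mul, RingQuot.mkAlgHom_rel R (.idem x)]
  kp1_orth x y h := by rw [← map_mul, RingQuot.mkAlgHom_rel R (.orth x y h), map_zero]
  kp2_mul m l hm hl := by rw [← map_mul, RingQuot.mkAlgHom_rel R (.path_mul m l hm hl)]
  kp2_mul_ghost m l hm hl := by rw [← map_mul, RingQuot.mkAlgHom_rel R (.ghost_mul m l hm hl)]
  kp2_range l := by rw [← map_mul, RingQuot.mkAlgHom_rel R (.range_mul l)]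
  kp2_source l := by rw [← map_mul, RingQuot.mkAlgHom_rel R (.mul_source l)]
  kp2_range_ghost l := by rw [← map_mul, RingQuot.mkAlgHom_rel R (.source_mul l)]
  kp2_source_ghost l := by rw [← map_mul, RingQuot.mkAlgHom_rel R (.mul_range l)]
  kp3 l m hd := by
    rw [← map_mul]
    split_ifs with h
    · subst h
      rw [RingQuot.mkAlgHom_rel R (.ghost_path_self l)]
    · rw [RingQuot.mkAlgHom_rel R (.ghost_path_of_ne l m hd h), map_zero]
  kp4 x n hn := by
    have := hfin.finite_edge x n
    rw [RingQuot.mkAlgHom_rel R (.sum x n hn), map_finsum _ (Set.toFinite _)]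
    simp only [map_mul]

variable {R}

theorem exists_unital_lift (hfin : RowFinite Λ) {A : Type*} [Ring A] [Algebra R A]
    (G : KumjianPaskFamily Λ A) : ∃ f : UnitalAlg Λ R →ₐ[R] A,
      (∀ x, f ((unitalFamily R hfin).P x) = G.P x) ∧
      (∀ l, f ((unitalFamily R hfin).S l) = G.S l) ∧
      ∀ l, f ((unitalFamily R hfin).S' l) = G.S' l := by
  let φ : FreeAlg Λ R →ₐ[R] A := FreeAlgebra.lift R (Sum.elim G.P (Sum.elim G.S G.S'))
  have hP : ∀ x, φ (freeP R x) = G.P x := fun x => FreeAlgebra.lift_ι_apply ..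
  have hS : ∀ l, φ (freeS R l) = G.S l := fun l => FreeAlgebra.lift_ι_apply ..
  have hS' : ∀ l, φ (freeS' R l) = G.S' l := fun l => FreeAlgebra.lift_ι_apply ..
  have hφ : ∀ ⦃a b⦄, Rel R a b → φ a = φ b := by
    intro a b h
    cases h with
    | idem x => simp only [map_mul, hP, G.kp1_idem]
    | orth x y h => simp only [map_mul, hP, G.kp1_orth x y h, map_zero]
    | path_mul m l hm hl => simp only [map_mul, hS, G.kp2_mul]
    | ghost_mul m l hm hl => simp only [map_mul, hS', G.kp2_mul_ghost]
    | range_mul l => simp only [map_mul, hP, hS, G.kp2_range]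
    | mul_source l => simp only [map_mul, hP, hS, G.kp2_source]
    | source_mul l => simp only [map_mul, hP, hS', G.kp2_range_ghost]
    | mul_range l => simp only [map_mul, hP, hS', G.kp2_source_ghost]
    | ghost_path_self l => rw [map_mul, hP, hS, hS', G.kp3 l l rfl, if_pos rfl]
    | ghost_path_of_ne l m hd h => rw [map_mul, hS, hS', G.kp3 l m hd, if_neg h, map_zero]
    | sum x n hn =>
      have := hfin.finite_edge x n
      rw [map_finsum _ (Set.toFinite _), hP, G.kp4 x n hn]
      simp only [map_mul, hS, hS']
  refine ⟨RingQuot.liftAlgHom R ⟨φ, hφ⟩, fun x => ?_, fun l => ?_, fun l => ?_⟩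
  · exact (RingQuot.liftAlgHom_mkAlgHom_apply R φ hφ _).trans (hP x)
  · exact (RingQuot.liftAlgHom_mkAlgHom_apply R φ hφ _).trans (hS l)
  · exact (RingQuot.liftAlgHom_mkAlgHom_apply R φ hφ _).trans (hS' l)

variable (R) in
/-- The Kumjian–Pask algebra of a row-finite `ℕ`-graph. -/
abbrev KPAlg (hfin : RowFinite Λ) : Type (max u v t) := (unitalFamily R hfin).generated R

variable (R) in
/-- The generating family of the Kumjian–Pask algebra. -/
noncomputable abbrev kpFamily (hfin : RowFinite Λ) : KumjianPaskFamily Λ (KPAlg R hfin) :=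
  (unitalFamily R hfin).toGenerated R hfin

/-- The unitization supplies the unit that the unital quotient demands. On the generated subalgebra
the scalar coordinate vanishes, and there the `A`-coordinate is multiplicative. -/
theorem exists_lift (hfin : RowFinite Λ) {A : Type*} [NonUnitalRing A] [Module R A]
    [IsScalarTower R A A] [SMulCommClass R A A] (G : KumjianPaskFamily Λ A) :
    ∃ f : KPAlg R hfin →ₙₐ[R] A, (kpFamily R hfin).MapsTo G f := by
  obtain ⟨φ, hP, hS, hS'⟩ := exists_unital_lift (R := R) hfin
    (G.map hfin (Unitization.inrNonUnitalAlgHom R A : A →ₙ+* Unitization R A))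
  have hfst : ∀ a : KPAlg R hfin, (φ a).fst = 0 := by
    rintro ⟨a, ha⟩
    induction ha using NonUnitalAlgebra.adjoin_induction with
    | mem x hx =>
      obtain ((⟨x, rfl⟩ | ⟨l, rfl⟩) | ⟨l, rfl⟩) := hx
      · exact (congrArg (fun y : Unitization R A => y.fst) (hP x)).trans (Unitization.fst_inr R _)
      · exact (congrArg (fun y : Unitization R A => y.fst) (hS l)).trans (Unitization.fst_inr R _)
      · exact (congrArg (fun y : Unitization R A => y.fst) (hS' l)).trans (Unitization.fst_inr R _)
    | zero => simp
    | add x y _ _ hx hy => simp_all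
    | mul x y _ _ hx hy => simp_all
    | smul r x _ hx => simp_all
  let f : KPAlg R hfin →ₙₐ[R] A :=
    { toFun := fun a => (φ a).snd
      map_smul' := fun r a => by simp
      map_zero' := by simp
      map_add' := fun a b => by simp
      map_mul' := fun a b => by simp [hfst] }
  exact ⟨f, fun x => (congrArg (fun y : Unitization R A => y.snd) (hP x)).trans (Unitization.snd_inr R _),
    fun l => (congrArg (fun y : Unitization R A => y.snd) (hS l)).trans (Unitization.snd_inr R _),
    fun l => (congrArg (fun y : Unitization R A => y.snd) (hS' l)).trans (Unitization.snd_inr R _)⟩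

variable (R) in
theorem kpFamily_isUniversal (hfin : RowFinite Λ) : (kpFamily R hfin).IsUniversal.{u, v, w} R := by
  intro A _ _ _ _ G
  obtain ⟨f, hf⟩ := exists_lift (R := R) hfin G
  exact ⟨f, hf, fun g hg => ((unitalFamily R hfin).toGenerated_generates hfin).hom_ext hg hf⟩

end Universal

/-! ### Independence of the components via a twist by degree. -/

section Coaction

variable (R : Type t) [CommRing R] {A : Type w} [NonUnitalRing A] [Module R A]
  [IsScalarTower R A A] [SMulCommClass R A A] (F : KumjianPaskFamily Λ A)

/-- A family, twisted by the degree. -/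
noncomputable def twist (hfin : RowFinite Λ) :
    KumjianPaskFamily Λ (AddMonoidAlgebra (Unitization R A) (ℕ →₀ ℤ)) where
  P x := .single 0 (F.P x : Unitization R A)
  S l := .single l.1.intDeg (F.S l : Unitization R A)
  S' l := .single (-l.1.intDeg) (F.S' l : Unitization R A)
  kp1_idem x := by
    rw [AddMonoidAlgebra.single_mul_single, ← Unitization.inr_mul, F.kp1_idem, add_zero]
  kp1_orth x y h := by
    rw [AddMonoidAlgebra.single_mul_single, ← Unitization.inr_mul, F.kp1_orth x y h]
    simp
  kp2_mul {x y z} m l hm hl := by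
    rw [AddMonoidAlgebra.single_mul_single, ← Unitization.inr_mul, F.kp2_mul]
    congr 1
    have := Path.intDeg_comp (⟨y, z, l⟩ : Path Λ) ⟨x, y, m⟩ rfl
    rw [Path.comp_mk] at this
    exact this.symm
  kp2_mul_ghost {x y z} m l hm hl := by
    rw [AddMonoidAlgebra.single_mul_single, ← Unitization.inr_mul, F.kp2_mul_ghost, ← neg_add_rev]
    congr 2
    have := Path.intDeg_comp (⟨y, z, l⟩ : Path Λ) ⟨x, y, m⟩ rfl
    rw [Path.comp_mk] at this
    exact this.symm
  kp2_range l := by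
    rw [AddMonoidAlgebra.single_mul_single, ← Unitization.inr_mul, F.kp2_range, zero_add]
  kp2_source l := by
    rw [AddMonoidAlgebra.single_mul_single, ← Unitization.inr_mul, F.kp2_source, add_zero]
  kp2_range_ghost l := by
    rw [AddMonoidAlgebra.single_mul_single, ← Unitization.inr_mul, F.kp2_range_ghost, zero_add]
  kp2_source_ghost l := by
    rw [AddMonoidAlgebra.single_mul_single, ← Unitization.inr_mul, F.kp2_source_ghost, add_zero]
  kp3 l m hd := by
    have hd' : l.1.intDeg = m.1.intDeg := by simp only [Path.intDeg, hd]
    rw [AddMonoidAlgebra.single_mul_single, ← Unitization.inr_mul, F.kp3 l m hd, hd',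
      neg_add_cancel]
    split_ifs <;> simp
  kp4 x n hn := by
    have := hfin.finite_edge x n
    have := Fintype.ofFinite {l : Edge Λ // l.1 ∈ pathsInto x n}
    rw [F.kp4 x n hn, finsum_eq_sum_of_fintype, finsum_eq_sum_of_fintype]
    let j : A →+ AddMonoidAlgebra (Unitization R A) (ℕ →₀ ℤ) :=
      (AddMonoidAlgebra.singleAddHom 0).comp
        (Unitization.inrNonUnitalAlgHom R A : A →+ Unitization R A)
    change j _ = _
    rw [map_sum]
    refine Finset.sum_congr rfl fun l _ => ?_
    rw [AddMonoidAlgebra.single_mul_single, add_neg_cancel, ← Unitization.inr_mul]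
    rfl

theorem twist_path (hfin : RowFinite Λ) (l : Path Λ) :
    (F.twist R hfin).path l = .single l.intDeg (F.path l : Unitization R A) := by
  unfold path
  split_ifs with h
  · rfl
  · rw [Path.intDeg_eq_zero (not_not.1 h)]
    rfl

theorem twist_ghost (hfin : RowFinite Λ) (l : Path Λ) :
    (F.twist R hfin).ghost l = .single (-l.intDeg) (F.ghost l : Unitization R A) := by
  unfold ghost
  split_ifs with h
  · rfl
  · rw [Path.intDeg_eq_zero (not_not.1 h), neg_zero]
    rfl

variable {R F}

theorem MapsTo.twist_apply {hfin : RowFinite Λ}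
    {f : A →ₙₐ[R] AddMonoidAlgebra (Unitization R A) (ℕ →₀ ℤ)}
    (hf : F.MapsTo (F.twist R hfin) f) {n : ℕ →₀ ℤ} {a : A} (ha : a ∈ F.component R n) :
    f a = .single n (a : Unitization R A) := by
  have hle : F.component R n ≤ LinearMap.eqLocus (f : A →ₗ[R] _)
      (AddMonoidAlgebra.lsingle n ∘ₗ Unitization.inrHom R R A) := by
    refine F.component_le R fun a b hab => ?_
    change f (F.path a * F.ghost b) = .single n ((F.path a * F.ghost b : A) : Unitization R A)
    rw [map_mul, hf.path, hf.ghost, twist_path, twist_ghost, AddMonoidAlgebra.single_mul_single,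
      ← sub_eq_add_neg, hab, Unitization.inr_mul]
  exact hle ha

/-- The coefficient at exponent `n` of the twisted homomorphism kills every other component and is
the injection into `Unitization R A` on the `n`-th. The universe `max t w` is that of the group
algebra. -/
theorem IsUniversal.iSupIndep_component (hfin : RowFinite Λ)
    (hu : IsUniversal.{u, v, max t w} R F) : iSupIndep (F.component R) := by
  obtain ⟨f, hf, -⟩ := hu _ (F.twist R hfin)
  intro n
  rw [Submodule.disjoint_def]
  intro a ha ha'
  have hle : ⨆ m, ⨆ (_ : m ≠ n), F.component R m ≤ LinearMap.ker
      ((Finsupp.lapply n : ((ℕ →₀ ℤ) →₀ Unitization R A) →ₗ[R] Unitization R A) ∘ₗ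
        (AddMonoidAlgebra.coeffLinearEquiv R).toLinearMap ∘ₗ (f : A →ₗ[R] _)) := by
    refine iSup₂_le fun m hm b hb => ?_
    change (f b).coeff n = 0
    rw [hf.twist_apply hb]
    simp [hm]
  have h : (f a).coeff n = 0 := hle ha'
  rw [hf.twist_apply ha] at h
  exact Unitization.inr_injective (R := R) (by simpa using h)

end Coaction

/-- A homomorphism between generating universal families is an isomorphism. -/
theorem IsUniversal.bijective {R : Type t} [CommRing R] {K : Type (max u v t)} [NonUnitalRing K]
    [Module R K] [IsScalarTower R K K] [SMulCommClass R K K] {B : Type (max u v t w)}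
    [NonUnitalRing B] [Module R B] [IsScalarTower R B B] [SMulCommClass R B B]
    {F : KumjianPaskFamily Λ K} {G : KumjianPaskFamily Λ B} (hfin : RowFinite Λ)
    (hF : F.Generates R) (hG : G.Generates R) (hu : IsUniversal.{u, v, max u v t w} R G)
    {f : K →ₙₐ[R] B} (hf : F.MapsTo G f) : Function.Bijective f := by
  refine ⟨?_, hG.surjective hf⟩
  -- The universality of `G` speaks only of algebras in a possibly larger universe than that of `K`,
  -- so it is applied to a lifted copy of `K`; following it with `down` gives a left inverse of `f`.
  have : IsScalarTower R (ULift.{max u v t w} K) (ULift.{max u v t w} K) :=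
    ⟨fun r x y => ULift.ext _ _ (smul_mul_assoc r x.down y.down)⟩
  have : SMulCommClass R (ULift.{max u v t w} K) (ULift.{max u v t w} K) :=
    ⟨fun r x y => ULift.ext _ _ (mul_smul_comm r x.down y.down).symm⟩
  let up : K →ₙ+* ULift.{max u v t w} K :=
    { toFun := ULift.up
      map_zero' := rfl
      map_add' := fun _ _ => rfl
      map_mul' := fun _ _ => rfl }
  let down : ULift.{max u v t w} K →ₙₐ[R] K :=
    { toFun := ULift.down
      map_smul' := fun _ _ => rfl
      map_zero' := rfl
      map_add' := fun _ _ => rfl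
      map_mul' := fun _ _ => rfl }
  obtain ⟨g, ⟨h₁, h₂, h₃⟩, -⟩ := hu (ULift.{max u v t w} K) (F.map hfin up)
  have hid : (down.comp g).comp f = NonUnitalAlgHom.id R K := by
    refine hF.hom_ext (G := F) ⟨fun x => ?_, fun l => ?_, fun l => ?_⟩
      ⟨fun _ => rfl, fun _ => rfl, fun _ => rfl⟩
    · change (g (f (F.P x))).down = F.P x
      rw [hf.1, h₁]
      rfl
    · change (g (f (F.S l))).down = F.S l
      rw [hf.2.1, h₂]
      rfl
    · change (g (f (F.S' l))).down = F.S' l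
      rw [hf.2.2, h₃]
      rfl
  exact Function.LeftInverse.injective (g := down.comp g) fun a => DFunLike.congr_fun hid a

end KumjianPaskFamily

theorem mainTheorem9 (Λ : Type u) [NGraph.{u, v} Λ] (hfin : NGraph.RowFinite Λ)
    (hsrc : NGraph.NoSources Λ) (R : Type t) [CommRing R] :
    ∃ (K : Type (max u v t)) (_ : NonUnitalRing K) (_ : Module R K) (_ : IsScalarTower R K K)
      (_ : SMulCommClass R K K) (F : KumjianPaskFamily Λ K),
      -- the family generates the algebra and is universal
      F.Generates R ∧
      KumjianPaskFamily.IsUniversal.{u, v, max u v t w} R F ∧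
      -- the algebra with its family is unique up to a unique compatible isomorphism
      (∀ (B : Type (max u v t w)) [NonUnitalRing B] [Module R B] [IsScalarTower R B B]
        [SMulCommClass R B B] (G : KumjianPaskFamily Λ B),
        G.Generates R → KumjianPaskFamily.IsUniversal.{u, v, max u v t w} R G →
          ∃! f : K →ₙₐ[R] B, Function.Bijective f ∧ F.MapsTo G f) ∧
      -- nonzero multiples of the vertex idempotents are nonzero
      (∀ (r : R) (x : Λ), r ≠ 0 → r • F.P x ≠ 0) ∧
      -- the spans form a grading
      (∀ (m n : ℕ →₀ ℤ), ∀ a ∈ F.component R m, ∀ b ∈ F.component R n,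
        a * b ∈ F.component R (m + n)) ∧
      DirectSum.IsInternal (F.component R) := by
  have hgen := (KumjianPaskFamily.unitalFamily R hfin).toGenerated_generates (R := R) hfin
  refine ⟨KumjianPaskFamily.KPAlg R hfin, inferInstance, inferInstance, inferInstance,
    inferInstance, KumjianPaskFamily.kpFamily R hfin, hgen,
    KumjianPaskFamily.kpFamily_isUniversal R hfin, ?_, ?_, ?_, ?_⟩
  · intro B _ _ _ _ G hG hu
    obtain ⟨f, hf⟩ := KumjianPaskFamily.exists_lift (R := R) hfin G
    exact ⟨f, ⟨hu.bijective hfin hgen hG hf, hf⟩, fun g hg => hgen.hom_ext hg.2 hf⟩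
  · intro r x hr h
    -- If `r • p_x` vanished, so would its image in the germ representation.
    obtain ⟨f, hf⟩ := KumjianPaskFamily.exists_lift (R := R) hfin (germFamily R hfin)
    refine smul_germFamily_P_ne_zero R hfin hsrc hr x ?_
    rw [← hf.1, ← map_smul, h, map_zero]
  · exact fun m n a ha b hb => KumjianPaskFamily.mul_mem_component R _ hfin m n ha hb
  · exact (DirectSum.isInternal_submodule_iff_iSupIndep_and_iSup_eq_top _).2
      ⟨(KumjianPaskFamily.kpFamily_isUniversal R hfin).iSupIndep_component hfin,
        KumjianPaskFamily.iSup_component_eq_top R _ hfin hgen⟩
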